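/- For a finite simple graph $G$ with vertex set $V$ and edge set $E(G)$, let $\mathcal P_G \subset \mathbb R^V$ be its symmetric edge polytope, i.e. the convex hull of $\{\pm(\mathbf e_i-\mathbf e_j) : \{i,j\}\in E(G)\}$, where $\mathbf e_i$ denotes the $i$-th unit coordinate vector, and let $N(\mathcal P_G)$ be the number of facets of $\mathcal P_G$ (faces of dimension $\dim \mathcal P_G-1$). Let $K_{\ell,m}$ denote the complete bipartite graph with parts of sizes $\ell$ and $m$. Let $G$ be a connected bipartite graph with $n\ge 2$ vertices. (a) If $n$ is odd, then $N(\mathcal P_G)\ge 3\cdot 2^{\frac{n-1}{2}}-2$, and equality holds if and only if $G$ is isomorphic to $K_{(n-1)/2,(n+1)/2}$. (b) If $n$ is even, then $N(\mathcal P_G)\ge 2^{\frac n2+1}-2$, and equality holds if and only if $G$ is isomorphic to $K_{n/2,n/2}$. -/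

import Mathlib

/-- The symmetric edge polytope of a graph `G` on `V`: the convex hull in `ℝ^V` of the vectors
`±(e_i - e_j)` over the edges `{i, j}` of `G`. Adjacency is symmetric, so both signs occur. -/
def symmetricEdgePolytope {V : Type*} [DecidableEq V] (G : SimpleGraph V) : Set (V → ℝ) :=
  convexHull ℝ {x | ∃ i j : V, G.Adj i j ∧ x = Pi.single i 1 - Pi.single j 1}

/-- `F` is a facet of the polytope `P`: a nonempty face of `P` (the set of points of `P` at which
some linear functional attains its maximum over `P`) whose dimension is `dim P - 1`, where the
dimension of a nonempty convex set is that of its affine hull. -/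
def IsFacet {E : Type*} [AddCommGroup E] [Module ℝ E] [TopologicalSpace E] (P F : Set E) : Prop :=
  F.Nonempty ∧ IsExposed ℝ P F ∧
    Module.finrank ℝ (vectorSpan ℝ F) + 1 = Module.finrank ℝ (vectorSpan ℝ P)

/-- The number of facets of the polytope `P`. -/
noncomputable def numFacets {E : Type*} [AddCommGroup E] [Module ℝ E] [TopologicalSpace E]
    (P : Set E) : ℕ :=
  Set.ncard {F : Set E | IsFacet P F}

/-! Facets correspond to height functions (`numFacets_symmetricEdgePolytope`). A facet is the set
where some `pairing g` attains its maximum 1, and having codimension one means that a function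
constant along all tight edges is constant (`eq_of_tight_of_isFacet`). Applied to the property
"integral, with parity given by the colour", this makes `g` integral and rules out difference 0 on
an edge.

Adding edges inside a bipartition only removes height functions, and each missing edge `u w` is
detected by the distance from `u`, so the complete bipartite graph on the colour classes is the
unique minimiser (`numFacets_add_two`). There a height function is constant on one class and free to
go up or down by one at each vertex of the other. Inclusion–exclusion gives `2 ^ a + 2 ^ b - 2` for
classes of sizes `a` and `b`, which is least for a balanced split. -/

/-- The linear functional `x ↦ ∑ v, g v * x v` on `ℝ^V`. -/
noncomputable def pairing {V : Type*} [Fintype V] (g : V → ℝ) : (V → ℝ) →L[ℝ] ℝ :=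
  ∑ v, g v • ContinuousLinearMap.proj (R := ℝ) (φ := fun _ : V => ℝ) v

/-- The functions `V → ℤ` vanishing at `v₀` that change by exactly one along each edge of `G`. -/
def heightFunctions {V : Type*} (G : SimpleGraph V) (v₀ : V) : Set (V → ℤ) :=
  {f | f v₀ = 0 ∧ ∀ i j, G.Adj i j → f i - f j = 1 ∨ f i - f j = -1}

/-- The part of the symmetric edge polytope on which `pairing g` takes the value one. -/
def levelFace {V : Type*} [Fintype V] [DecidableEq V] (G : SimpleGraph V) (g : V → ℝ) :
    Set (V → ℝ) :=
  {x | x ∈ symmetricEdgePolytope G ∧ pairing g x = 1}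

theorem eq_of_adj_of_connected {V α : Type*} {G : SimpleGraph V} (hconn : G.Connected) {φ : V → α}
    (hφ : ∀ i j, G.Adj i j → φ i = φ j) (u v : V) : φ u = φ v := by
  obtain ⟨w⟩ := hconn.preconnected u v
  induction w with
  | nil => rfl
  | cons h _ ih => exact (hφ _ _ h).trans ih

/-- Every edge is tight for `f` in one of its orientations, so `f - f'` is constant along edges,
hence zero by connectedness. -/
theorem heightFunction_injective {V : Type*} {G : SimpleGraph V} (hconn : G.Connected) {v₀ : V} {f f' : V → ℤ}
    (hf : f ∈ heightFunctions G v₀) (hf' : f' ∈ heightFunctions G v₀)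
    (h : ∀ i j, G.Adj i j → f i - f j = 1 → f' i - f' j = 1) : f = f' := by
  have key := eq_of_adj_of_connected hconn (φ := fun v => f v - f' v) fun i j hij => by
    have h1 := h i j hij
    have h2 := h j i hij.symm
    rcases hf.2 i j hij with h3 | h3
    · have := h1 h3
      omega
    · have := h2 (by omega)
      omega
  funext v
  have := key v v₀
  simp only [hf.1, hf'.1] at this
  omega

theorem finite_heightFunctions {V : Type*} [Finite V] {G : SimpleGraph V} (hconn : G.Connected)
    (v₀ : V) : (heightFunctions G v₀).Finite := by
  refine Set.Finite.of_finite_image (f := fun f (q : V × V) => decide (f q.1 - f q.2 = 1))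
    (Set.toFinite _) fun f hf f' hf' h => heightFunction_injective hconn hf hf' fun i j _ hij => ?_
  simpa [hij] using congrFun h (i, j)

theorem pairing_apply {V : Type*} [Fintype V] (g x : V → ℝ) : pairing g x = ∑ v, g v * x v := by
  simp [pairing]

/-! ### Facets of the polytope and height functions -/

section Polytope

variable {V : Type*} [DecidableEq V] {G : SimpleGraph V}

theorem single_sub_single_mem_symmetricEdgePolytope {i j : V} (h : G.Adj i j) :
    (Pi.single i 1 - Pi.single j 1 : V → ℝ) ∈ symmetricEdgePolytope G :=
  subset_convexHull ℝ _ ⟨i, j, h, rfl⟩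

theorem neg_mem_symmetricEdgePolytope {x : V → ℝ} (hx : x ∈ symmetricEdgePolytope G) :
    -x ∈ symmetricEdgePolytope G := by
  have hS : -{x : V → ℝ | ∃ i j : V, G.Adj i j ∧ x = Pi.single i 1 - Pi.single j 1} =
      {x | ∃ i j : V, G.Adj i j ∧ x = Pi.single i 1 - Pi.single j 1} := by
    ext y
    constructor
    · rintro ⟨i, j, h, hy⟩
      exact ⟨j, i, h.symm, by rw [← neg_neg y, hy, neg_sub]⟩
    · rintro ⟨i, j, h, hy⟩
      exact ⟨j, i, h.symm, by rw [hy, neg_sub]⟩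
  unfold symmetricEdgePolytope at *
  rw [← hS, convexHull_neg]
  simpa using hx

/-- Central symmetry gives `2x = x - (-x)`, so the direction space is the full linear span. -/
theorem mem_vectorSpan_symmetricEdgePolytope {x : V → ℝ} (hx : x ∈ symmetricEdgePolytope G) :
    x ∈ vectorSpan ℝ (symmetricEdgePolytope G) := by
  have h := vsub_mem_vectorSpan ℝ hx (neg_mem_symmetricEdgePolytope hx)
  have h2 := Submodule.smul_mem _ (2⁻¹ : ℝ) h
  have hx2 : (2⁻¹ : ℝ) • (x -ᵥ -x) = x := by
    rw [vsub_eq_sub, sub_neg_eq_add, ← two_smul ℝ x, smul_smul]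
    norm_num
  rwa [hx2] at h2

theorem vectorSpan_symmetricEdgePolytope_le {W : Submodule ℝ (V → ℝ)}
    (hW : ∀ i j, G.Adj i j → (Pi.single i 1 - Pi.single j 1 : V → ℝ) ∈ W) :
    vectorSpan ℝ (symmetricEdgePolytope G) ≤ W := by
  have hP : symmetricEdgePolytope G ⊆ W := by
    refine convexHull_min ?_ W.convex
    rintro _ ⟨i, j, h, rfl⟩
    exact hW i j h
  refine Submodule.span_le.2 ?_
  rintro _ ⟨x, hx, y, hy, rfl⟩
  exact W.sub_mem (hP hx) (hP hy)

variable [Fintype V]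

theorem pairing_single_sub_single (g : V → ℝ) (i j : V) :
    pairing g (Pi.single i 1 - Pi.single j 1) = g i - g j := by
  simp [pairing_apply, mul_sub, Finset.sum_sub_distrib, Pi.single_apply]

theorem pairing_le_one {g : V → ℝ} (hg : ∀ i j, G.Adj i j → g i - g j ≤ 1) {x : V → ℝ}
    (hx : x ∈ symmetricEdgePolytope G) : pairing g x ≤ 1 := by
  have hconv : Convex ℝ {x : V → ℝ | pairing g x ≤ 1} :=
    convex_halfSpace_le (pairing g).toLinearMap.isLinear 1
  refine convexHull_min ?_ hconv hx
  rintro _ ⟨i, j, h, rfl⟩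
  simpa [pairing_single_sub_single] using hg i j h

/-- A functional that vanishes on the vertices of a face vanishes on the face. -/
theorem pairing_eq_zero_of_mem_levelFace {g φ : V → ℝ} (hg : ∀ i j, G.Adj i j → g i - g j ≤ 1)
    (hφ : ∀ i j, G.Adj i j → g i - g j = 1 → φ i = φ j) {x : V → ℝ} (hx : x ∈ levelFace G g) :
    pairing φ x = 0 := by
  have hconv : Convex ℝ {x : V → ℝ | pairing g x ≤ 1 ∧ (pairing g x = 1 → pairing φ x = 0)} := by
    refine convex_iff_forall_pos.2 ?_
    rintro x ⟨hx1, hx2⟩ y ⟨hy1, hy2⟩ a b ha hb hab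
    simp only [Set.mem_ofPred_eq, map_add, map_smul, smul_eq_mul]
    refine ⟨by nlinarith, fun h => ?_⟩
    have hx3 : pairing g x = 1 := by nlinarith
    have hy3 : pairing g y = 1 := by nlinarith
    rw [hx2 hx3, hy2 hy3]
    simp
  refine (convexHull_min ?_ hconv hx.1).2 hx.2
  rintro _ ⟨i, j, h, rfl⟩
  simp only [Set.mem_ofPred_eq, pairing_single_sub_single]
  exact ⟨hg i j h, fun h1 => by rw [hφ i j h h1, sub_self]⟩

theorem vectorSpan_levelFace_le_ker (g : V → ℝ) :
    vectorSpan ℝ (levelFace G g) ≤ LinearMap.ker (pairing g).toLinearMap := by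
  refine Submodule.span_le.2 ?_
  rintro _ ⟨x, hx, y, hy, rfl⟩
  simp [hx.2, hy.2]

/-- `pairing g` kills the direction of the face but is 1 at `p`. Hence the face is a facet exactly
when its linear span is that of the polytope. -/
theorem finrank_vectorSpan_levelFace_sup {g p : V → ℝ} (hp : p ∈ levelFace G g) :
    Module.finrank ℝ ↥(vectorSpan ℝ (levelFace G g) ⊔ Submodule.span ℝ {p}) =
      Module.finrank ℝ (vectorSpan ℝ (levelFace G g)) + 1 := by
  have hp0 : p ≠ 0 := by
    rintro rfl
    simpa using hp.2
  have hdisj : vectorSpan ℝ (levelFace G g) ⊓ Submodule.span ℝ {p} = ⊥ := by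
    refine (Submodule.eq_bot_iff _).2 ?_
    rintro x ⟨hx1, hx2⟩
    obtain ⟨c, rfl⟩ := Submodule.mem_span_singleton.1 hx2
    have h := vectorSpan_levelFace_le_ker g hx1
    have hc : c = 0 := by simpa [hp.2] using h
    simp [hc]
  have h := Submodule.finrank_sup_add_finrank_inf_eq (vectorSpan ℝ (levelFace G g))
    (Submodule.span ℝ {p})
  rwa [hdisj, finrank_bot, add_zero, finrank_span_singleton hp0] at h

theorem vectorSpan_levelFace_sup_le {g p : V → ℝ} (hp : p ∈ levelFace G g) :
    vectorSpan ℝ (levelFace G g) ⊔ Submodule.span ℝ {p} ≤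
      vectorSpan ℝ (symmetricEdgePolytope G) := by
  refine sup_le (vectorSpan_mono ℝ fun x hx => hx.1) ?_
  rw [Submodule.span_singleton_le_iff_mem]
  exact mem_vectorSpan_symmetricEdgePolytope hp.1

theorem single_sub_single_mem_levelFace {g : V → ℝ} {i j : V} (h : G.Adj i j)
    (hg : g i - g j = 1) : (Pi.single i 1 - Pi.single j 1 : V → ℝ) ∈ levelFace G g :=
  ⟨single_sub_single_mem_symmetricEdgePolytope h, by rw [pairing_single_sub_single, hg]⟩

theorem isExposed_levelFace {g p : V → ℝ} (hg : ∀ i j, G.Adj i j → g i - g j ≤ 1)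
    (hp : p ∈ levelFace G g) : IsExposed ℝ (symmetricEdgePolytope G) (levelFace G g) := by
  refine fun _ => ⟨pairing g, ?_⟩
  ext x
  refine and_congr_right fun hx => ⟨fun h y hy => ?_, fun h => ?_⟩
  · rw [h]
    exact pairing_le_one hg hy
  · exact le_antisymm (pairing_le_one hg hx) (hp.2 ▸ h p hp.1)

/-- If every edge changes `g` by exactly one, then `g` defines a facet. -/
theorem isFacet_levelFace {g : V → ℝ} {a b : V} (hab : G.Adj a b)
    (hg : ∀ i j, G.Adj i j → g i - g j = 1 ∨ g i - g j = -1) :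
    IsFacet (symmetricEdgePolytope G) (levelFace G g) := by
  have hle : ∀ i j, G.Adj i j → g i - g j ≤ 1 := fun i j h => by
    rcases hg i j h with h | h <;> rw [h]; norm_num
  obtain ⟨p, hp⟩ : (levelFace G g).Nonempty := by
    rcases hg a b hab with h | h
    · exact ⟨_, single_sub_single_mem_levelFace hab h⟩
    · exact ⟨_, single_sub_single_mem_levelFace hab.symm (by linarith)⟩
  refine ⟨⟨p, hp⟩, isExposed_levelFace hle hp, ?_⟩
  rw [← finrank_vectorSpan_levelFace_sup hp]
  refine congrArg (fun W : Submodule ℝ (V → ℝ) => Module.finrank ℝ W)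
    (le_antisymm (vectorSpan_levelFace_sup_le hp) (vectorSpan_symmetricEdgePolytope_le ?_))
  have key : ∀ i j, G.Adj i j → g i - g j = 1 → (Pi.single i 1 - Pi.single j 1 : V → ℝ) ∈
      vectorSpan ℝ (levelFace G g) ⊔ Submodule.span ℝ {p} := fun i j h h1 => by
    have h2 := vsub_mem_vectorSpan ℝ (single_sub_single_mem_levelFace h h1) hp
    have h3 := Submodule.add_mem_sup h2 (Submodule.mem_span_singleton_self (R := ℝ) p)
    rwa [vsub_eq_sub, sub_add_cancel] at h3
  intro i j h
  rcases hg i j h with h1 | h1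
  · exact key i j h h1
  · rw [← neg_sub]
    exact Submodule.neg_mem _ (key j i h.symm (by linarith))

/-- Every facet is the level face of a function vanishing at `v₀`. -/
theorem IsFacet.exists_eq_levelFace {F : Set (V → ℝ)} (hF : IsFacet (symmetricEdgePolytope G) F)
    (v₀ : V) : ∃ g : V → ℝ, g v₀ = 0 ∧ (∀ i j, G.Adj i j → g i - g j ≤ 1) ∧ F = levelFace G g := by
  obtain ⟨⟨p, hp⟩, hexp, hdim⟩ := hF
  obtain ⟨l, hl⟩ := hexp ⟨p, hp⟩
  have hp' : p ∈ symmetricEdgePolytope G ∧ ∀ y ∈ symmetricEdgePolytope G, l y ≤ l p := by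
    rw [hl] at hp
    exact hp
  -- By symmetry a nonpositive maximum makes `l` vanish on the polytope, so `F` would be all of it,
  -- against the dimension.
  have hpos : 0 < l p := by
    by_contra hneg
    have hFP : F = symmetricEdgePolytope G := by
      rw [hl]
      refine Set.eq_of_subset_of_subset (fun x hx => hx.1) fun x hx => ⟨hx, fun y hy => ?_⟩
      have h1 := hp'.2 y hy
      have h2 := hp'.2 _ (neg_mem_symmetricEdgePolytope hx)
      rw [map_neg] at h2
      linarith
    rw [hFP] at hdim
    omega
  have hcomp : ∀ i j, G.Adj i j → l (Pi.single i 1) - l (Pi.single j 1) ≤ l p := fun i j h => by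
    simpa using hp'.2 _ (single_sub_single_mem_symmetricEdgePolytope h)
  -- The shift is invisible on the polytope, since edge vectors have coordinate sum zero; the
  -- division makes the maximum 1.
  set g : V → ℝ := fun v => (l (Pi.single v 1) - l (Pi.single v₀ 1)) / l p with hg
  have hgle : ∀ i j, G.Adj i j → g i - g j ≤ 1 := fun i j h => by
    rw [hg, ← sub_div, div_le_one hpos]
    linarith [hcomp i j h]
  have hpair : ∀ x ∈ symmetricEdgePolytope G, pairing g x = l x / l p := by
    have hconv : Convex ℝ {x : V → ℝ | pairing g x = l x / l p} := by
      intro x hx y hy a b _ _ _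
      simp only [Set.mem_ofPred_eq, map_add, map_smul, smul_eq_mul] at hx hy ⊢
      rw [hx, hy]
      ring
    refine fun x hx => convexHull_min ?_ hconv hx
    rintro _ ⟨i, j, h, rfl⟩
    rw [Set.mem_ofPred_eq, pairing_single_sub_single, map_sub]
    simp only [hg]
    ring
  refine ⟨g, by simp [hg], hgle, ?_⟩
  ext x
  rw [hl]
  refine and_congr_right fun hx => ?_
  rw [hpair x hx, div_eq_one_iff_eq hpos.ne']
  exact ⟨fun h => le_antisymm (hp'.2 x hx) (h p hp'.1), fun h y hy => h ▸ hp'.2 y hy⟩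

/-- The edges on which a facet-defining function is tight generate: a function constant along
them is constant. -/
theorem eq_of_tight_of_isFacet (hconn : G.Connected) {g φ : V → ℝ}
    (hg : ∀ i j, G.Adj i j → g i - g j ≤ 1)
    (hF : IsFacet (symmetricEdgePolytope G) (levelFace G g))
    (hφ : ∀ i j, G.Adj i j → g i - g j = 1 → φ i = φ j) (u v : V) : φ u = φ v := by
  obtain ⟨⟨p, hp⟩, -, hdim⟩ := hF
  have heq := Submodule.eq_of_le_of_finrank_eq (vectorSpan_levelFace_sup_le hp)
    ((finrank_vectorSpan_levelFace_sup hp).trans hdim)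
  have hker : vectorSpan ℝ (symmetricEdgePolytope G) ≤ LinearMap.ker (pairing φ).toLinearMap := by
    rw [← heq]
    refine sup_le (Submodule.span_le.2 ?_) ?_
    · rintro _ ⟨x, hx, y, hy, rfl⟩
      simp [pairing_eq_zero_of_mem_levelFace hg hφ hx, pairing_eq_zero_of_mem_levelFace hg hφ hy]
    · rw [Submodule.span_singleton_le_iff_mem]
      exact pairing_eq_zero_of_mem_levelFace hg hφ hp
  refine eq_of_adj_of_connected hconn (fun i j h => ?_) u v
  have h1 : pairing φ (Pi.single i 1 - Pi.single j 1) = 0 :=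
    hker (mem_vectorSpan_symmetricEdgePolytope (single_sub_single_mem_symmetricEdgePolytope h))
  rw [pairing_single_sub_single] at h1
  linarith

/-- A function defining a facet of the polytope of a connected bipartite graph is integral and
changes by one along each edge. -/
theorem exists_heightFunction_of_isFacet (hconn : G.Connected) {c : V → Bool}
    (hc : ∀ i j, G.Adj i j → c i ≠ c j) {v₀ : V} {g : V → ℝ} (h0 : g v₀ = 0)
    (hg : ∀ i j, G.Adj i j → g i - g j ≤ 1)
    (hF : IsFacet (symmetricEdgePolytope G) (levelFace G g)) :
    ∃ f ∈ heightFunctions G v₀, g = fun v => (f v : ℝ) := by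
  classical
  let Q : V → Prop := fun v => ∃ k : ℤ, g v = k ∧ (Even k ↔ c v = c v₀)
  have hshift : ∀ i j, G.Adj i j → ∀ k m : ℤ, (Even m ↔ ¬ Even k) →
      (Even k ↔ c i = c v₀) → (Even m ↔ c j = c v₀) := by
    intro i j h k m hkm hk
    have := hc i j h
    rw [hkm, hk]
    revert this
    cases c i <;> cases c j <;> cases c v₀ <;> simp
  have htight : ∀ i j, G.Adj i j → g i - g j = 1 → (Q i ↔ Q j) := by
    intro i j h h1
    constructor
    · rintro ⟨k, hk, hk2⟩
      refine ⟨k - 1, by push_cast; linarith, hshift i j h k (k - 1) ?_ hk2⟩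
      simp
    · rintro ⟨k, hk, hk2⟩
      refine ⟨k + 1, by push_cast; linarith, hshift j i h.symm k (k + 1) ?_ hk2⟩
      simp
  have hall : ∀ v, Q v := by
    intro v
    -- The indicator of `Q` is constant along tight edges, hence constant.
    have h := eq_of_tight_of_isFacet hconn hg hF (φ := fun v => if Q v then 1 else 0)
      (fun i j h h1 => by simp only [htight i j h h1]) v v₀
    have hQ0 : Q v₀ := ⟨0, by simp [h0], by simp⟩
    by_contra hv
    simp [hQ0, hv] at h
  choose f hf hfc using hall
  refine ⟨f, ⟨by exact_mod_cast (hf v₀).symm.trans h0, fun i j h => ?_⟩, funext hf⟩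
  have h1 := hg i j h
  have h2 := hg j i h.symm
  rw [hf, hf] at h1 h2
  have h1' : f i - f j ≤ 1 := by exact_mod_cast h1
  have h2' : f j - f i ≤ 1 := by exact_mod_cast h2
  -- Equal values have equal parity, which would give the ends of an edge the same colour.
  have h3 : f i - f j ≠ 0 := fun h3 => by
    have h4 : f i = f j := by omega
    have h5 := hfc i
    rw [h4, hfc j] at h5
    have := hc i j h
    revert this h5
    cases c i <;> cases c j <;> cases c v₀ <;> simp
  omega

/-- The facets of the symmetric edge polytope of a connected bipartite graph are counted by its
height functions. -/
theorem numFacets_symmetricEdgePolytope (hconn : G.Connected) {c : V → Bool}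
    (hc : ∀ i j, G.Adj i j → c i ≠ c j) {a b : V} (hab : G.Adj a b) (v₀ : V) :
    numFacets (symmetricEdgePolytope G) = (heightFunctions G v₀).ncard := by
  have hcast : ∀ f ∈ heightFunctions G v₀, ∀ i j, G.Adj i j →
      (f i : ℝ) - f j = 1 ∨ (f i : ℝ) - f j = -1 := fun f hf i j h => by
    exact_mod_cast hf.2 i j h
  symm
  refine Set.ncard_congr (fun f _ => levelFace G fun v => (f v : ℝ)) ?_ ?_ ?_
  · exact fun f hf => isFacet_levelFace hab (hcast f hf)
  · intro f f' hf hf' h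
    refine heightFunction_injective hconn hf hf' fun i j hij h1 => ?_
    have hmem : (Pi.single i 1 - Pi.single j 1 : V → ℝ) ∈ levelFace G fun v => (f v : ℝ) :=
      single_sub_single_mem_levelFace hij (by exact_mod_cast h1)
    rw [h] at hmem
    have h2 := hmem.2
    rw [pairing_single_sub_single] at h2
    exact_mod_cast h2
  · intro F hF
    obtain ⟨g, h0, hg, rfl⟩ := IsFacet.exists_eq_levelFace hF v₀
    obtain ⟨f, hf, rfl⟩ := exists_heightFunction_of_isFacet hconn hc h0 hg hF
    exact ⟨f, hf, rfl⟩

end Polytope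

/-! ### Counting height functions -/

section Counting

open Finset

variable {V : Type*}

/-- A graph on `V` has at least as many height functions as the complete bipartite graph on the
colour classes of a proper colouring. -/
theorem heightFunctions_comap_top_subset {G : SimpleGraph V} {c : V → Bool}
    (hc : ∀ i j, G.Adj i j → c i ≠ c j) (v₀ : V) :
    heightFunctions ((⊤ : SimpleGraph Bool).comap c) v₀ ⊆ heightFunctions G v₀ :=
  fun _ hf => ⟨hf.1, fun i j h => hf.2 i j (hc i j h)⟩

/-- If two vertices of different colours are not adjacent, the distance from one of them is a
height function that the complete bipartite graph does not have. -/
theorem exists_heightFunction_not_mem {G : SimpleGraph V} (hconn : G.Connected) {c : V → Bool}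
    (hc : ∀ i j, G.Adj i j → c i ≠ c j) (v₀ : V) {u w : V} (huw : c u ≠ c w)
    (hadj : ¬ G.Adj u w) :
    ∃ f ∈ heightFunctions G v₀, f ∉ heightFunctions ((⊤ : SimpleGraph Bool).comap c) v₀ := by
  refine ⟨fun v => (G.dist u v : ℤ) - G.dist u v₀, ⟨sub_self _, fun i j h => ?_⟩, fun hf => ?_⟩
  · let C : G.Coloring Bool := SimpleGraph.Coloring.mk c fun {i j} h => hc i j h
    have hpar : ∀ v, Even (G.dist u v) ↔ (c u ↔ c v) := fun v => by
      obtain ⟨p, hp⟩ := hconn.exists_walk_length_eq_dist u v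
      rw [← hp]
      exact C.even_length_iff_congr p
    have hne : G.dist u i ≠ G.dist u j := fun heq => by
      have h1 := hpar i
      rw [heq, hpar j] at h1
      have := hc i j h
      revert h1 this
      cases c i <;> cases c j <;> cases c u <;> simp
    have h1 := hconn.dist_triangle (u := u) (v := i) (w := j)
    have h2 := hconn.dist_triangle (u := u) (v := j) (w := i)
    rw [SimpleGraph.dist_eq_one_iff_adj.2 h] at h1
    rw [SimpleGraph.dist_eq_one_iff_adj.2 h.symm] at h2
    dsimp only
    omega
  · have h1 := hf.2 u w huw
    have h2 : G.dist u w ≠ 1 := fun h => hadj (SimpleGraph.dist_eq_one_iff_adj.1 h)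
    simp only [SimpleGraph.dist_self] at h1
    omega

/-- The height functions of the complete bipartite graph that are constant off the colour `ε`. -/
def heightFunctionsConstOff (c : V → Bool) (v₀ : V) (ε : Bool) : Set (V → ℤ) :=
  {f | f ∈ heightFunctions ((⊤ : SimpleGraph Bool).comap c) v₀ ∧
    ∀ i j, c i ≠ ε → c j ≠ ε → f i = f j}

/-- Two distinct values on one class differ by 2, and every value on the other class must be their
midpoint. -/
theorem heightFunctions_comap_top_eq_union (c : V → Bool) (v₀ : V) :
    heightFunctions ((⊤ : SimpleGraph Bool).comap c) v₀ =
      heightFunctionsConstOff c v₀ true ∪ heightFunctionsConstOff c v₀ false := by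
  refine Set.Subset.antisymm (fun f hf => ?_) (Set.union_subset (fun f hf => hf.1) fun f hf => hf.1)
  by_contra hcon
  simp only [heightFunctionsConstOff, Set.mem_union, Set.mem_ofPred_eq, hf, true_and, not_or,
    not_forall] at hcon
  obtain ⟨⟨i, j, hi, hj, hij⟩, k, l, hk, hl, hkl⟩ := hcon
  simp only [Bool.not_eq_true, Bool.not_eq_false] at hi hj hk hl
  have h1 := hf.2 i k (by simp [hi, hk])
  have h2 := hf.2 i l (by simp [hi, hl])
  have h3 := hf.2 j k (by simp [hj, hk])
  have h4 := hf.2 j l (by simp [hj, hl])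
  omega

theorem ncard_heightFunctionsConstOff_inter {c : V → Bool} {p q : V} (hp : c p = true)
    (hq : c q = false) (v₀ : V) :
    (heightFunctionsConstOff c v₀ true ∩ heightFunctionsConstOff c v₀ false).ncard = 2 := by
  refine Set.ncard_eq_two.2 ⟨fun v => (c v).toInt - (c v₀).toInt,
    fun v => (c v₀).toInt - (c v).toInt, fun h => ?_, ?_⟩
  · have h1 := congrFun h p
    have h2 := congrFun h q
    simp only [hp, hq, Bool.toInt_true, Bool.toInt_false] at h1 h2
    omega
  · ext f
    simp only [Set.mem_inter_iff, Set.mem_insert_iff, Set.mem_singleton_iff]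
    constructor
    · rintro ⟨⟨hf, ht⟩, -, hf'⟩
      have hval : ∀ v, f v = if c v then f p else f q := fun v => by
        cases hv : c v
        · exact ht v q (by simp [hv]) (by simp [hq])
        · exact hf' v p (by simp [hv]) (by simp [hp])
      have h0 := hval v₀
      rw [hf.1] at h0
      rcases hf.2 p q (by simp [hp, hq]) with h | h
      · left
        funext v
        rw [hval v]
        cases c v <;> cases hv : c v₀ <;> simp [hv] at h0 ⊢ <;> omega
      · right
        funext v
        rw [hval v]
        cases c v <;> cases hv : c v₀ <;> simp [hv] at h0 ⊢ <;> omega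
    · rintro (rfl | rfl) <;>
      · refine ⟨⟨⟨sub_self _, fun i j h => ?_⟩, fun i j hi hj => ?_⟩,
          ⟨sub_self _, fun i j h => ?_⟩, fun i j hi hj => ?_⟩ <;>
        · simp only [SimpleGraph.comap_adj, SimpleGraph.top_adj] at *
          cases hci : c i <;> cases hcj : c j <;> cases c v₀ <;> simp_all

/-- A subset of the class `ε` records which vertices lie above the constant level; the others lie
below it. -/
theorem ncard_heightFunctionsConstOff [Fintype V] [DecidableEq V] {c : V → Bool} {ε : Bool}
    {q : V} (hq : c q ≠ ε) (v₀ : V) :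
    (heightFunctionsConstOff c v₀ ε).ncard = 2 ^ #{v | c v = ε} := by
  rw [← card_powerset, ← Set.ncard_coe_finset]
  let s : Finset V → V → ℤ := fun T v => if c v = ε then (if v ∈ T then 1 else -1) else 0
  symm
  refine Set.ncard_congr (fun T _ v => s T v - s T v₀) ?_ ?_ ?_
  · refine fun T _ => ⟨⟨sub_self _, fun i j h => ?_⟩, fun i j hi hj => by simp [s, hi, hj]⟩
    have h : c i ≠ c j := h
    rw [sub_sub_sub_cancel_right]
    by_cases hi : c i = ε
    · have hj : c j ≠ ε := fun hj => h (hi.trans hj.symm)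
      simp only [s, if_pos hi, if_neg hj]
      split_ifs <;> simp
    · have hj : c j = ε := by
        revert h hi
        cases c i <;> cases c j <;> cases ε <;> simp
      simp only [s, if_neg hi, if_pos hj]
      split_ifs <;> simp
  · intro T T' hT hT' h
    simp only [coe_powerset, Set.mem_preimage, Set.mem_powerset_iff, coe_subset] at hT hT'
    -- Both level functions vanish at `q`, so the normalising shifts agree.
    have h0 : s T v₀ = s T' v₀ := by
      have h1 := congrFun h q
      simp only [s, if_neg hq] at h1
      simp only [s]
      omega
    ext v
    by_cases hv : c v = ε
    · have h1 := congrFun h v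
      simp only [h0, sub_left_inj] at h1
      simp only [s, if_pos hv] at h1
      split_ifs at h1 <;> simp_all
    · exact ⟨fun h2 => absurd (by simpa using hT h2) hv, fun h2 => absurd (by simpa using hT' h2) hv⟩
  · rintro f ⟨hf, hconst⟩
    refine ⟨({v | c v = ε ∧ f v = f q + 1} : Finset V), ?_, ?_⟩
    · simp only [coe_powerset, Set.mem_preimage, Set.mem_powerset_iff, coe_subset]
      intro v
      simp +contextual
    · have hs : ∀ v, s ({v | c v = ε ∧ f v = f q + 1} : Finset V) v = f v - f q := fun v => by
        by_cases hv : c v = ε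
        · have h1 := hf.2 v q (show c v ≠ c q from fun h => hq (h ▸ hv))
          simp only [s, if_pos hv, mem_filter, mem_univ, true_and, hv]
          split_ifs <;> omega
        · simp only [s, if_neg hv, hconst v q hv hq, sub_self]
      funext v
      rw [hs, hs, hf.1]
      omega

theorem ncard_heightFunctions_comap_top [Fintype V] [DecidableEq V] {c : V → Bool} {p q : V}
    (hp : c p = true) (hq : c q = false) (v₀ : V) :
    (heightFunctions ((⊤ : SimpleGraph Bool).comap c) v₀).ncard + 2 =
      2 ^ #{v | c v = true} + 2 ^ #{v | c v = false} := by
  have h1 := ncard_heightFunctionsConstOff (c := c) (ε := true) (q := q) (by simp [hq]) v₀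
  have h2 := ncard_heightFunctionsConstOff (c := c) (ε := false) (q := p) (by simp [hp]) v₀
  rw [← h1, ← h2, ← ncard_heightFunctionsConstOff_inter hp hq v₀,
    heightFunctions_comap_top_eq_union]
  exact Set.ncard_union_add_ncard_inter _ _
    (Set.finite_of_ncard_pos (h1 ▸ by positivity)) (Set.finite_of_ncard_pos (h2 ▸ by positivity))

/-- The number of facets is at least that of the complete bipartite graph on the same colour
classes, with equality only for that graph. -/
theorem numFacets_add_two [Fintype V] [DecidableEq V] {G : SimpleGraph V} (hconn : G.Connected)
    {c : V → Bool} (hc : ∀ i j, G.Adj i j → c i ≠ c j) {p q : V} (hpq : G.Adj p q) :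
    2 ^ #{v | c v = true} + 2 ^ #{v | c v = false} ≤ numFacets (symmetricEdgePolytope G) + 2 ∧
      (numFacets (symmetricEdgePolytope G) + 2 = 2 ^ #{v | c v = true} + 2 ^ #{v | c v = false} ↔
        ∀ i j, c i ≠ c j → G.Adj i j) := by
  wlog hp : c p = true generalizing p q
  · refine this hpq.symm ?_
    have := hc p q hpq
    revert this hp
    cases c p <;> cases c q <;> simp
  have hq : c q = false := by simpa [hp] using (hc p q hpq).symm
  have hfin := finite_heightFunctions hconn p
  have hsub := heightFunctions_comap_top_subset hc p
  rw [← ncard_heightFunctions_comap_top hp hq p, numFacets_symmetricEdgePolytope hconn hc hpq p,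
    Nat.add_right_cancel_iff]
  refine ⟨Nat.add_le_add_right (Set.ncard_le_ncard hsub hfin) 2, fun h i j hij => ?_, fun h => ?_⟩
  · by_contra hadj
    obtain ⟨f, hf, hf'⟩ := exists_heightFunction_not_mem hconn hc p hij hadj
    rw [← Set.eq_of_subset_of_ncard_le hsub h.le hfin] at hf
    exact hf' hf
  · congr 2
    ext i j
    exact ⟨hc i j, h i j⟩

/-- A bipartite graph with all edges between its colour classes is complete bipartite. -/
theorem nonempty_iso_completeBipartiteGraph [Fintype V] [DecidableEq V] {G : SimpleGraph V}
    {c : V → Bool} (hG : ∀ i j, G.Adj i j ↔ c i ≠ c j) {ε : Bool} {k m : ℕ}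
    (hk : #{v | c v = ε} = k) (hm : #{v | c v = !ε} = m) :
    Nonempty (G ≃g completeBipartiteGraph (Fin k) (Fin m)) := by
  have e1 : {v // c v = ε} ≃ Fin k := Fintype.equivFinOfCardEq (by rw [Fintype.card_subtype, hk])
  have e2 : {v // ¬ c v = ε} ≃ Fin m := Fintype.equivFinOfCardEq (by
    rw [Fintype.card_subtype, ← hm]
    congr 1
    ext v
    simp [Bool.eq_not])
  refine ⟨⟨(Equiv.sumCompl fun v => c v = ε).symm.trans (Equiv.sumCongr e1 e2), ?_⟩⟩
  intro i j
  rw [hG]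
  by_cases hi : c i = ε <;> by_cases hj : c j = ε
  · simp [hi, hj, Equiv.sumCompl_symm_apply_of_pos]
  · simp [hi, hj, Equiv.sumCompl_symm_apply_of_pos, Equiv.sumCompl_symm_apply_of_neg, Ne.symm hj]
  · simp [hi, hj, Equiv.sumCompl_symm_apply_of_pos, Equiv.sumCompl_symm_apply_of_neg]
  · have hij : c i = c j := by rw [Bool.eq_not.2 hi, Bool.eq_not.2 hj]
    simp [hj, hij, Equiv.sumCompl_symm_apply_of_neg]

theorem numFacets_of_iso_completeBipartiteGraph [Fintype V] [DecidableEq V] {G : SimpleGraph V}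
    (hconn : G.Connected) {k m : ℕ} (e : G ≃g completeBipartiteGraph (Fin k) (Fin m)) {p q : V}
    (hpq : G.Adj p q) : numFacets (symmetricEdgePolytope G) + 2 = 2 ^ k + 2 ^ m := by
  have hG : ∀ i j, G.Adj i j ↔ (e i).isLeft ≠ (e j).isLeft := fun i j => by
    rw [← e.map_adj_iff, completeBipartiteGraph_adj]
    cases e i <;> cases e j <;> simp
  have h1 : #{v | (e v).isLeft = true} = k := by
    rw [card_equiv e.toEquiv (t := univ.map Function.Embedding.inl)]
    · simp
    · intro v
      change _ ↔ e v ∈ _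
      cases h : e v <;> simp [h]
  have h2 : #{v | (e v).isLeft = false} = m := by
    rw [card_equiv e.toEquiv (t := univ.map Function.Embedding.inr)]
    · simp
    · intro v
      change _ ↔ e v ∈ _
      cases h : e v <;> simp [h]
  have h := (numFacets_add_two hconn (c := fun v => (e v).isLeft) (fun i j => (hG i j).1) hpq).2.2
    fun i j => (hG i j).2
  rw [h, h1, h2]

/-! ### Minimising a sum of two powers of two with given exponent sum, and the conclusion -/

theorem two_pow_add_two_pow_even {a b k : ℕ} (hab : a + b = 2 * k) :
    2 ^ (k + 1) ≤ 2 ^ a + 2 ^ b ∧ (2 ^ a + 2 ^ b = 2 ^ (k + 1) → a = k ∧ b = k) := by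
  have key : ∀ a b : ℕ, k < a → 2 ^ (k + 1) < 2 ^ a + 2 ^ b := fun a b h =>
    (Nat.pow_le_pow_right two_pos h).trans_lt (Nat.lt_add_of_pos_right (by positivity))
  rcases lt_trichotomy a k with h | rfl | h
  · have := key b a (by omega)
    omega
  · obtain rfl : b = a := by omega
    simp [pow_succ, mul_two]
  · have := key a b h
    omega

theorem two_pow_add_two_pow_odd {a b k : ℕ} (hab : a + b = 2 * k + 1) :
    3 * 2 ^ k ≤ 2 ^ a + 2 ^ b ∧
      (2 ^ a + 2 ^ b = 3 * 2 ^ k → a = k ∧ b = k + 1 ∨ a = k + 1 ∧ b = k) := by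
  have key : ∀ a b : ℕ, k + 1 < a → 3 * 2 ^ k < 2 ^ a + 2 ^ b := fun a b h => by
    have h1 : 2 ^ (k + 2) ≤ 2 ^ a := Nat.pow_le_pow_right two_pos h
    have h2 : 0 < 2 ^ b := by positivity
    rw [pow_add] at h1
    omega
  rcases lt_or_ge (k + 1) a with h | h
  · have := key a b h
    omega
  rcases lt_or_ge (k + 1) b with h' | h'
  · have := key b a h'
    omega
  obtain ⟨rfl, rfl⟩ | ⟨rfl, rfl⟩ : a = k ∧ b = k + 1 ∨ a = k + 1 ∧ b = k := by omega
  · exact ⟨by rw [pow_succ]; omega, fun _ => Or.inl ⟨rfl, rfl⟩⟩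
  · exact ⟨by rw [pow_succ]; omega, fun _ => Or.inr ⟨rfl, rfl⟩⟩

end Counting

theorem proposition2p8 {V : Type*} [Fintype V] [DecidableEq V] (G : SimpleGraph V) (n : ℕ)
    (hn : Fintype.card V = n) (hn2 : 2 ≤ n) (hconn : G.Connected) (hbip : G.IsBipartite) :
    (Odd n →
      3 * 2 ^ ((n - 1) / 2) - 2 ≤ numFacets (symmetricEdgePolytope G) ∧
      (numFacets (symmetricEdgePolytope G) = 3 * 2 ^ ((n - 1) / 2) - 2 ↔
        Nonempty (G ≃g completeBipartiteGraph (Fin ((n - 1) / 2)) (Fin ((n + 1) / 2))))) ∧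
    (Even n →
      2 ^ (n / 2 + 1) - 2 ≤ numFacets (symmetricEdgePolytope G) ∧
      (numFacets (symmetricEdgePolytope G) = 2 ^ (n / 2 + 1) - 2 ↔
        Nonempty (G ≃g completeBipartiteGraph (Fin (n / 2)) (Fin (n / 2))))) := by
  obtain ⟨C⟩ := hbip
  obtain ⟨c, hc⟩ : ∃ c : V → Bool, ∀ i j, G.Adj i j → c i ≠ c j :=
    ⟨fun v => finTwoEquiv (C v), fun i j h => finTwoEquiv.injective.ne (C.valid h)⟩
  obtain ⟨p, q, hpq⟩ : ∃ p q, G.Adj p q := by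
    by_contra! hno
    have : Nontrivial V := Fintype.one_lt_card_iff_nontrivial.1 (by omega)
    obtain ⟨x, y, hxy⟩ := exists_pair_ne V
    exact hxy (eq_of_adj_of_connected hconn (φ := id) (fun i j h => absurd h (hno i j)) x y)
  obtain ⟨hle, heq⟩ := numFacets_add_two hconn hc hpq
  have hcard : (Finset.univ.filter fun v => c v = true).card +
      (Finset.univ.filter fun v => c v = false).card = n := by
    have h := Finset.card_filter_add_card_filter_not (s := (Finset.univ : Finset V)) (fun v => c v = true)
    simpa only [Bool.not_eq_true, Finset.card_univ, hn] using h
  have hG : (∀ i j, c i ≠ c j → G.Adj i j) → ∀ i j, G.Adj i j ↔ c i ≠ c j :=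
    fun h i j => ⟨hc i j, h i j⟩
  constructor
  · rintro ⟨k, rfl⟩
    have e1 : (2 * k + 1 - 1) / 2 = k := by omega
    have e2 : (2 * k + 1 + 1) / 2 = k + 1 := by omega
    obtain ⟨hmin, hmin'⟩ := two_pow_add_two_pow_odd hcard
    have hpos : 0 < 2 ^ k := by positivity
    rw [e1, e2]
    refine ⟨by omega, fun h => ?_, fun ⟨e⟩ => ?_⟩
    · have hG' := hG (heq.1 (by omega))
      -- Either colour may be the smaller class; `ε` selects it.
      rcases hmin' (by omega) with ⟨h1, h2⟩ | ⟨h1, h2⟩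
      · exact nonempty_iso_completeBipartiteGraph hG' (ε := true) h1 h2
      · exact nonempty_iso_completeBipartiteGraph hG' (ε := false) h2 h1
    · have h := numFacets_of_iso_completeBipartiteGraph hconn e hpq
      rw [pow_succ] at h
      omega
  · rintro ⟨k, rfl⟩
    have e1 : (k + k) / 2 = k := by omega
    obtain ⟨hmin, hmin'⟩ := two_pow_add_two_pow_even (hcard.trans (two_mul k).symm)
    -- Keeps the natural-number subtraction of 2 from truncating.
    have hpos : 2 ≤ 2 ^ (k + 1) := Nat.le_self_pow (by omega) 2
    rw [e1]
    refine ⟨by omega, fun h => ?_, fun ⟨e⟩ => ?_⟩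
    · obtain ⟨h1, h2⟩ := hmin' (by omega)
      exact nonempty_iso_completeBipartiteGraph (hG (heq.1 (by omega))) (ε := true) h1 h2
    · have h := numFacets_of_iso_completeBipartiteGraph hconn e hpq
      rw [pow_succ] at hpos hmin ⊢
      omega
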